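/- Let $R>0$ and let $n\ge 2$ be an integer. The $n$-con is the solid in $\mathbb R^3$ (coordinates $x,y,z$) constructed as follows. (I) Take the solid right circular cone standing on the plane $z=0$, with axis the $z$-axis, radius $R$ and apex angle $\pi-\frac{\pi}{n}$. (II) Cut off and discard two wedges along the two planes that contain the $y$-axis and make angle $\frac{\pi}{2}-\frac{\pi}{n}$ with the horizontal; that is, keep the part where $z\ge |x|\tan(\frac{\pi}{2}-\frac{\pi}{n})$. (III) Glue $n$ copies of this piece along their flat faces around the $y$-axis; that is, take the union of the rotations of the piece about the $y$-axis through $\frac{2\pi k}{n}$, $0\le k<n$. (IV) Cut the result into two halves by the plane $y=0$, rotate one half about the $y$-axis through $\frac{\pi}{n}$, and take the union of the two halves. The $2$-con is the sphericon and the $3$-con is the hexacon. The surface area of the $n$-con, that is, the two-dimensional area (Hausdorff measure) of its boundary, is $$\frac{nR^2}{\cos\left(\frac{\pi}{2n}\right)}\,I_n,\qquad I_n=\int_{-\pi/2}^{\pi/2}\frac{d\theta}{(1+e^{\ast}\cos\theta)^2},\qquad e^{\ast}=\cot\left(\tfrac{\pi}{n}\right)\cot\left(\tfrac{\pi}{2n}\right),$$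 where $I_2=\pi$, $I_3=\frac43$, and, for $n>3$, with $c=\cos\frac{\pi}{n}$ and $q=\cos\left(\frac{\pi}{2n}-\frac{\pi}{3}\right)\cos\left(\frac{\pi}{2n}+\frac{\pi}{3}\right)$, $$I_n=\frac{1-c}{q}\left[\frac{c}{2}-\frac{(1-c)^2}{4\sqrt q}\,\log\left(\frac{1+2\sqrt q}{1-2\sqrt q}\right)\right].$$ In particular, the surface area of the sphericon is $2\sqrt2\,\pi R^2$ and that of the hexacon is $\dfrac{8R^2}{\sqrt3}$. -/

import Mathlib

open Real MeasureTheory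

/-- The solid right circular cone sitting on the horizontal `(x,y)`-plane, with axis the `z`-axis,
radius `R` and apex angle `π - π / n`, so that its sloped surface makes the angle `π / (2 n)` with
the horizontal. The coordinates `x, y, z` are `p 0, p 1, p 2`. -/
def solidCone (n : ℕ) (R : ℝ) : Set (EuclideanSpace ℝ (Fin 3)) :=
  {p | 0 ≤ p 2 ∧ p 2 ≤ (R - √(p 0 ^ 2 + p 1 ^ 2)) * tan (π / (2 * n))}

/-- The piece of the cone that is kept after two wedges have been cut off by the two planes that
meet the `(x,y)`-plane in the `y`-axis and make the angle `π / 2 - π / n` with it. -/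
def conePiece (n : ℕ) (R : ℝ) : Set (EuclideanSpace ℝ (Fin 3)) :=
  {p | p ∈ solidCone n R ∧ |p 0| * tan (π / 2 - π / n) ≤ p 2}

/-- The rotation of space about the `y`-axis through the angle `φ`. -/
noncomputable def rotY (φ : ℝ) (p : EuclideanSpace ℝ (Fin 3)) : EuclideanSpace ℝ (Fin 3) :=
  !₂[cos φ * p 0 + sin φ * p 2, p 1, -sin φ * p 0 + cos φ * p 2]

/-- The spindle: `n` congruent pieces glued together along their flat faces, around the `y`-axis. -/
def spindle (n : ℕ) (R : ℝ) : Set (EuclideanSpace ℝ (Fin 3)) :=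
  ⋃ k : Fin n, rotY (2 * π * (k : ℕ) / n) '' conePiece n R

/-- The `n`-con: the spindle is cut into two halves by the plane `y = 0`, one of the halves is
rotated through `π / n`, and the halves are glued together again. -/
def polycon (n : ℕ) (R : ℝ) : Set (EuclideanSpace ℝ (Fin 3)) :=
  {p | p ∈ spindle n R ∧ 0 ≤ p 1} ∪ rotY (π / n) '' {p | p ∈ spindle n R ∧ p 1 ≤ 0}

/-- The surface area of a solid: the two-dimensional Hausdorff measure, normalised to agree with
Lebesgue measure on planes, of its topological boundary. -/
noncomputable def surfaceArea (S : Set (EuclideanSpace ℝ (Fin 3))) : ENNReal :=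
  μHE[2] (frontier S)

/-- The eccentricity of the projections to the horizontal plane of the edges of the piece. -/
noncomputable def projEccentricity (n : ℕ) : ℝ :=
  cot (π / n) * cot (π / (2 * n))

/-- The integral `I_n` of the volume and surface area formulas. -/
noncomputable def polyconIntegral (n : ℕ) : ℝ :=
  ∫ θ in (-(π / 2))..(π / 2), 1 / (1 + projEccentricity n * cos θ) ^ 2

/-- The product `cos (π/2n - π/3) cos (π/2n + π/3)` in the closed form of `I_n`. -/
noncomputable def cosProd (n : ℕ) : ℝ :=
  cos (π / (2 * n) - π / 3) * cos (π / (2 * n) + π / 3)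

/-!
The `n`-con and its spindle are sublevel sets of continuous functions on space that are positively
homogeneous of degree one (here called gauges), so their boundaries are level sets. Inside the wedge
around the upper half of the `z`-axis occupied by one piece, the gauge of the spindle is
`z cos α + √(x² + y²) sin α` with `α = π / (2 n)`, whose level sets are cones of slope `α`; in
general it is a function of `p` and of the largest `z`-coordinate of the `n` rotated copies of `p`.
Rotating one half of the spindle through `π / n` keeps the gauge continuous, because the plane
`y = 0` meets the spindle in a regular `2n`-gon. Hence the boundary of the `n`-con consists of
`2n` congruent pieces of a cone, which overlap in null sets.

Each piece is a graph, with constant Jacobian `1 / cos α`, over a planar region bounded by a line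
through the origin and by two arcs `‖z‖ + e |Re z| = R` of conics with focus at the origin and
eccentricity `e = cot (π / n) cot (π / (2 n))`. Its area in polar coordinates is
`R² / 2 * ∫ dθ / (1 + e cos θ)²`. The derivative of `sin θ / (1 + e cos θ)` reduces this integral to
`∫ dθ / (1 + e cos θ)`, which for `e > 1` is elementary through `e = (1 + k²) / (1 - k²)`.
-/

local notation "E³" => EuclideanSpace ℝ (Fin 3)

/-! ### Area of images of maps with constant Jacobian -/

section HausdorffArea

open scoped NNReal ENNReal
open Module

lemma euclideanHausdorffMeasure_image_le_mul {ι X Y : Type*} [MetricSpace X]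
    [MeasurableSpace X] [BorelSpace X] [MetricSpace Y] [MeasurableSpace Y] [BorelSpace Y]
    {f : ι → X} {g : ι → Y} {s : Set ι} {K : ℝ≥0} (d : ℕ)
    (h : ∀ a ∈ s, ∀ b ∈ s, dist (f a) (f b) ≤ K * dist (g a) (g b)) :
    μHE[d] (f '' s) ≤ (K : ℝ≥0∞) ^ d * μHE[d] (g '' s) := by
  rcases s.eq_empty_or_nonempty with rfl | ⟨a₀, -⟩
  · simp
  have : Nonempty ι := ⟨a₀⟩
  have hsection : ∀ y ∈ g '' s, ∃ a ∈ s, g a = y := fun y hy ↦ hy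
  choose! σ hσ hgσ using hsection
  have hfσ : ∀ a ∈ s, f (σ (g a)) = f a := fun a ha ↦ by
    have hle := h _ (hσ _ ⟨a, ha, rfl⟩) a ha
    rw [hgσ _ ⟨a, ha, rfl⟩, dist_self, mul_zero] at hle
    exact dist_le_zero.1 hle
  have hlip : LipschitzOnWith K (f ∘ σ) (g '' s) :=
    LipschitzOnWith.of_dist_le_mul fun x hx y hy ↦ by
      simpa only [Function.comp_apply, hgσ x hx, hgσ y hy] using h _ (hσ x hx) _ (hσ y hy)
  have himage : (f ∘ σ) '' (g '' s) = f '' s := by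
    rw [Set.image_image]
    exact Set.image_congr hfσ
  have hle := hlip.hausdorffMeasure_image_le (d := d) (by positivity)
  rw [himage, ENNReal.rpow_natCast] at hle
  simp only [Measure.euclideanHausdorffMeasure_def, Measure.smul_apply, ENNReal.smul_def,
    smul_eq_mul]
  rw [mul_left_comm]
  gcongr

variable {E F : Type*} [NormedAddCommGroup E] [NormedSpace ℝ E] [FiniteDimensional ℝ E]
  [NormedAddCommGroup F] [NormedSpace ℝ F]

lemma exists_approximatesLinearOn_imp_dist_le {A : E →L[ℝ] F} (hA : Function.Injective A)
    {K : ℝ≥0} (hK : 1 < K) :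
    ∃ r : ℝ≥0, r ≠ 0 ∧ ∀ (f : E → F) (s : Set E), ApproximatesLinearOn f A s r →
      ∀ x ∈ s, ∀ y ∈ s, dist (f x) (f y) ≤ K * dist (A x) (A y) ∧
        dist (A x) (A y) ≤ K * dist (f x) (f y) := by
  obtain ⟨κ, hκ, hanti⟩ := A.toLinearMap.exists_antilipschitzWith (LinearMap.ker_eq_bot.2 hA)
  refine ⟨(1 - K⁻¹) / κ, (div_pos (tsub_pos_of_lt (inv_lt_one_of_one_lt₀ hK)) hκ).ne',
    fun f s hf x hx y hy ↦ ?_⟩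
  have hκ' : (0 : ℝ) < κ := hκ
  have hK' : (1 : ℝ) < K := hK
  have herror : ‖f x - f y - A (x - y)‖ ≤ (1 - (K : ℝ)⁻¹) * ‖A (x - y)‖ := by
    have hxy : ‖x - y‖ ≤ κ * ‖A (x - y)‖ := by
      simpa [dist_eq_norm] using hanti.le_mul_dist x y
    have hr : (((1 - K⁻¹) / κ : ℝ≥0) : ℝ) = (1 - (K : ℝ)⁻¹) / κ := by
      push_cast [NNReal.coe_sub (inv_lt_one_of_one_lt₀ hK).le]
      rfl
    calc ‖f x - f y - A (x - y)‖ ≤ (1 - (K : ℝ)⁻¹) / κ * ‖x - y‖ := hr ▸ hf x hx y hy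
      _ ≤ (1 - (K : ℝ)⁻¹) / κ * (κ * ‖A (x - y)‖) := by
        gcongr
        exact div_nonneg (sub_nonneg.2 (inv_le_one_of_one_le₀ hK'.le)) hκ'.le
      _ = (1 - (K : ℝ)⁻¹) * ‖A (x - y)‖ := by field_simp
  rw [dist_eq_norm, dist_eq_norm, ← map_sub]
  have hinv : 2 - (K : ℝ)⁻¹ ≤ K := by
    have := two_mul_le_add_sq 1 (K : ℝ)
    field_simp
    linarith
  constructor
  · have := norm_le_norm_add_norm_sub' (f x - f y) (A (x - y))
    nlinarith [norm_nonneg (A (x - y))]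
  · have := norm_le_norm_add_norm_sub (f x - f y) (A (x - y))
    rw [← inv_mul_le_iff₀ (by positivity)]
    linarith

lemma exists_partition_dist_le_of_hasFDerivWithinAt [MeasurableSpace E] [BorelSpace E]
    [SecondCountableTopology F] {f : E → F} {f' : E → E →L[ℝ] F} {s : Set E}
    (hne : s.Nonempty) (hs : MeasurableSet s)
    (hf : ∀ x ∈ s, HasFDerivWithinAt f (f' x) s x)
    (hinj : ∀ x ∈ s, Function.Injective (f' x)) {K : ℝ≥0} (hK : 1 < K) :
    ∃ (t : ℕ → Set E) (y : ℕ → E), Pairwise (Function.onFun Disjoint t) ∧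
      (∀ n, MeasurableSet (t n)) ∧ ⋃ n, t n = s ∧ (∀ n, y n ∈ s) ∧
      ∀ n, ∀ a ∈ t n, ∀ b ∈ t n, dist (f a) (f b) ≤ K * dist (f' (y n) a) (f' (y n) b) ∧
        dist (f' (y n) a) (f' (y n) b) ≤ K * dist (f a) (f b) := by
  have hradius : ∀ A : E →L[ℝ] F, ∃ r : ℝ≥0, r ≠ 0 ∧ (Function.Injective A →
      ∀ t : Set E, ApproximatesLinearOn f A t r → ∀ a ∈ t, ∀ b ∈ t,
        dist (f a) (f b) ≤ K * dist (A a) (A b) ∧ dist (A a) (A b) ≤ K * dist (f a) (f b)) := by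
    intro A
    by_cases hA : Function.Injective A
    · obtain ⟨r, hr, happrox⟩ := exists_approximatesLinearOn_imp_dist_le hA hK
      exact ⟨r, hr, fun _ ↦ happrox f⟩
    · exact ⟨1, one_ne_zero, fun h ↦ absurd h hA⟩
  choose r hr happrox using hradius
  obtain ⟨t, A, hdisj, htm, hcover, hAt, hAf'⟩ :=
    exists_partition_approximatesLinearOn_of_hasFDerivWithinAt f s f' hf r hr
  choose y hys hy using hAf' hne
  refine ⟨fun n ↦ s ∩ t n, y, fun m n hmn ↦ (hdisj hmn).mono Set.inter_subset_right
    Set.inter_subset_right, fun n ↦ hs.inter (htm n), ?_, hys, fun n ↦ ?_⟩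
  · rw [← Set.inter_iUnion, Set.inter_eq_left.2 hcover]
  · rw [← hy n]
    exact happrox (A n) (hy n ▸ hinj _ (hys n)) _ (hAt n)

lemma ennreal_le_of_forall_one_lt_le_pow_mul {a b : ℝ≥0∞} (d : ℕ)
    (h : ∀ K : ℝ≥0, 1 < K → a ≤ (K : ℝ≥0∞) ^ d * b) : a ≤ b := by
  have hlim : Filter.Tendsto (fun K : ℝ≥0 ↦ ((K ^ d : ℝ≥0) : ℝ≥0∞) * b)
      (nhdsWithin 1 (Set.Ioi 1)) (nhds (((1 ^ d : ℝ≥0) : ℝ≥0∞) * b)) :=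
    ENNReal.Tendsto.mul_const (ENNReal.tendsto_coe.2
      (((continuous_pow d).tendsto 1).mono_left nhdsWithin_le_nhds)) (Or.inl (by simp))
  simp only [one_pow, ENNReal.coe_one, one_mul, ENNReal.coe_pow] at hlim
  exact ge_of_tendsto hlim (Filter.eventually_of_mem self_mem_nhdsWithin h)

lemma euclideanHausdorffMeasure_image_eq_ofReal_mul_volume {U V : Type*}
    [NormedAddCommGroup U] [InnerProductSpace ℝ U] [FiniteDimensional ℝ U] [MeasurableSpace U]
    [BorelSpace U] [NormedAddCommGroup V] [InnerProductSpace ℝ V] [SecondCountableTopology V]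
    [MeasurableSpace V] [BorelSpace V] {f : U → V} {f' : U → U →L[ℝ] V} {s : Set U}
    {J : ℝ} (hJ : J ≠ 0) (hs : MeasurableSet s)
    (hf : ∀ x ∈ s, HasFDerivWithinAt f (f' x) s x)
    (hf' : ∀ x ∈ s, (f' x).toLinearMap.normDet = J) (hinj : Set.InjOn f s) :
    μHE[finrank ℝ U] (f '' s) = ENNReal.ofReal J * volume s := by
  rcases s.eq_empty_or_nonempty with rfl | hne
  · simp
  have hf'inj : ∀ x ∈ s, Function.Injective (f' x) := fun x hx ↦
    ((f' x).toLinearMap.normDet_ne_zero_tfae.out 0 4).1 (hf' x hx ▸ hJ)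
  have hbounds : ∀ K : ℝ≥0, 1 < K →
      μHE[finrank ℝ U] (f '' s) ≤ (K : ℝ≥0∞) ^ finrank ℝ U * (ENNReal.ofReal J * volume s) ∧
      ENNReal.ofReal J * volume s ≤ (K : ℝ≥0∞) ^ finrank ℝ U * μHE[finrank ℝ U] (f '' s) := by
    intro K hK
    obtain ⟨t, y, hdisj, htm, rfl, hys, hdist⟩ :=
      exists_partition_dist_le_of_hasFDerivWithinAt hne hs hf hf'inj hK
    have hts := Set.subset_iUnion t
    have hvolume : ∀ n, ENNReal.ofReal J * volume (t n) =
        μHE[finrank ℝ U] (f' (y n) '' t n) := fun n ↦ by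
      rw [← hf' _ (hys n)]
      exact ((f' (y n)).toLinearMap.euclideanHausdorffMeasure_image_eq_normDet_mul_volume _).symm
    have himage : ∀ n, MeasurableSet (f '' t n) := fun n ↦
      (htm n).image_of_continuousOn_injOn
        (fun x hx ↦ ((hf x (hts n hx)).mono (hts n)).continuousWithinAt) (hinj.mono (hts n))
    have hdisj' : Pairwise (Function.onFun Disjoint fun n ↦ f '' t n) := fun m n hmn ↦
      (hdisj hmn).image hinj (hts m) (hts n)
    rw [Set.image_iUnion, measure_iUnion hdisj' himage, measure_iUnion hdisj htm,
      ← ENNReal.tsum_mul_left, ← ENNReal.tsum_mul_left, ← ENNReal.tsum_mul_left]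
    simp only [hvolume]
    exact ⟨ENNReal.tsum_le_tsum fun n ↦ euclideanHausdorffMeasure_image_le_mul _
        fun a ha b hb ↦ (hdist n a ha b hb).1,
      ENNReal.tsum_le_tsum fun n ↦ euclideanHausdorffMeasure_image_le_mul _
        fun a ha b hb ↦ (hdist n a ha b hb).2⟩
  exact le_antisymm (ennreal_le_of_forall_one_lt_le_pow_mul _ fun K hK ↦ (hbounds K hK).1)
    (ennreal_le_of_forall_one_lt_le_pow_mul _ fun K hK ↦ (hbounds K hK).2)

end HausdorffArea

/-! ### The cone as a graph over the horizontal plane -/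

/-- The lateral surface of the cone with base radius `R` whose slope makes the angle `α` with the
horizontal, as a graph over the horizontal plane, which is identified with `ℂ`. -/
noncomputable def coneMap (R α : ℝ) (z : ℂ) : E³ :=
  !₂[z.re, z.im, (R - ‖z‖) * tan α]

/-- The derivative of `coneMap R α` at `z ≠ 0`. -/
noncomputable def coneMapDeriv (α : ℝ) (z : ℂ) : ℂ →L[ℝ] E³ :=
  (PiLp.continuousLinearEquiv 2 ℝ fun _ : Fin 3 ↦ ℝ).symm.toContinuousLinearMap ∘L
    ContinuousLinearMap.pi ![Complex.reCLM, Complex.imCLM, -(tan α / ‖z‖) • innerSL ℝ z]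

lemma coneMapDeriv_apply (α : ℝ) (z v : ℂ) :
    coneMapDeriv α z v = !₂[v.re, v.im, -(tan α / ‖z‖) * inner ℝ z v] := by
  ext i
  fin_cases i <;> simp [coneMapDeriv]

lemma hasFDerivAt_norm_of_ne_zero {E : Type*} [NormedAddCommGroup E] [InnerProductSpace ℝ E]
    {x : E} (hx : x ≠ 0) : HasFDerivAt (fun y : E ↦ ‖y‖) (‖x‖⁻¹ • innerSL ℝ x) x := by
  have h := (hasStrictFDerivAt_norm_sq x).hasFDerivAt.sqrt (by simpa using hx)
  simp only [sqrt_sq (norm_nonneg _)] at h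
  convert h using 1
  ext v
  simp only [smul_apply, coe_innerSL_apply, smul_eq_mul, one_div, mul_inv_rev, nsmul_eq_mul,
    Nat.cast_ofNat]
  ring

lemma hasFDerivWithinAt_coneMap (R α : ℝ) {z : ℂ} (hz : z ≠ 0) (s : Set ℂ) :
    HasFDerivWithinAt (coneMap R α) (coneMapDeriv α z) s z := by
  refine hasFDerivWithinAt_euclidean.2 fun i ↦ HasFDerivAt.hasFDerivWithinAt ?_
  fin_cases i
  · exact Complex.reCLM.hasFDerivAt
  · exact Complex.imCLM.hasFDerivAt
  · refine (((hasFDerivAt_norm_of_ne_zero hz).const_sub R).mul_const (tan α)).congr_fderiv ?_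
    ext v
    change tan α * -(‖z‖⁻¹ * inner ℝ z v) = coneMapDeriv α z v 2
    rw [coneMapDeriv_apply]
    change _ = -(tan α / ‖z‖) * inner ℝ z v
    ring

lemma inner_coneMapDeriv (α : ℝ) (z v w : ℂ) :
    inner ℝ (coneMapDeriv α z v) (coneMapDeriv α z w) =
      inner ℝ v w + (tan α / ‖z‖) ^ 2 * (inner ℝ z v * inner ℝ z w) := by
  rw [coneMapDeriv_apply, coneMapDeriv_apply, EuclideanSpace.inner_eq_star_dotProduct,
    dotProduct, Fin.sum_univ_three]
  simp only [Complex.inner, Matrix.cons_val_zero, Matrix.cons_val_one, Matrix.cons_val,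
    Complex.mul_re, Complex.conj_re, Complex.conj_im, Pi.star_apply, star_trivial]
  ring

lemma normDet_coneMapDeriv {α : ℝ} (hα : 0 < cos α) {z : ℂ} (hz : z ≠ 0) :
    (coneMapDeriv α z).toLinearMap.normDet = 1 / cos α := by
  have hdet : (coneMapDeriv α z).toLinearMap.normDet ^ 2 = 1 + tan α ^ 2 :=
    calc (coneMapDeriv α z).toLinearMap.normDet ^ 2
      _ = 1 + (tan α / ‖z‖) ^ 2 * (z.re ^ 2 + z.im ^ 2) := by
        refine ((coneMapDeriv α z).toLinearMap.normDet_sq_eq_det_gram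
          Complex.orthonormalBasisOneI).trans ?_
        simp only [Matrix.gram, Matrix.det_fin_two, Matrix.of_apply, Matrix.cons_val_zero,
          Matrix.cons_val_one, Matrix.cons_val_fin_one, ContinuousLinearMap.coe_coe,
          inner_coneMapDeriv, Complex.coe_orthonormalBasisOneI, Complex.inner, Complex.mul_re,
          Complex.conj_re, Complex.conj_im, Complex.one_re, Complex.one_im, Complex.I_re,
          Complex.I_im]
        ring
      _ = 1 + tan α ^ 2 := by
        have hnorm : ‖z‖ ^ 2 = z.re ^ 2 + z.im ^ 2 := by
          rw [Complex.sq_norm, Complex.normSq_apply]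
          ring
        rw [← hnorm, ← mul_pow, div_mul_cancel₀ _ (norm_ne_zero_iff.2 hz)]
  rw [one_div, ← inv_sqrt_one_add_tan_sq hα, inv_inv, ← hdet,
    sqrt_sq (LinearMap.normDet_nonneg _)]

lemma injective_coneMap (R α : ℝ) : Function.Injective (coneMap R α) := fun _ _ h ↦
  Complex.ext (congrFun (congrArg WithLp.ofLp h) 0) (congrFun (congrArg WithLp.ofLp h) 1)

lemma euclideanHausdorffMeasure_singleton {X : Type*} [MetricSpace X] [MeasurableSpace X]
    [BorelSpace X] (x : X) {d : ℕ} (hd : 0 < d) : μHE[d] ({x} : Set X) = 0 := by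
  have := Measure.nullSingletonClass_hausdorff X (d := (d : ℝ)) (by exact_mod_cast hd)
  rw [Measure.euclideanHausdorffMeasure_def, Measure.smul_apply, measure_singleton, smul_zero]

lemma euclideanHausdorffMeasure_image_coneMap (R : ℝ) {α : ℝ} (hα : 0 < cos α) {s : Set ℂ}
    (hs : MeasurableSet s) :
    μHE[2] (coneMap R α '' s) = ENNReal.ofReal (1 / cos α) * volume s := by
  have harea : μHE[2] (coneMap R α '' (s \ {0})) =
      ENNReal.ofReal (1 / cos α) * volume (s \ {0}) := by
    rw [← Complex.finrank_real_complex]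
    exact euclideanHausdorffMeasure_image_eq_ofReal_mul_volume (by positivity)
      (hs.diff (measurableSet_singleton 0))
      (fun z hz ↦ hasFDerivWithinAt_coneMap R α hz.2 _) (fun z hz ↦ normDet_coneMapDeriv hα hz.2)
      (injective_coneMap R α).injOn
  have hapex : μHE[2] (coneMap R α '' {0}) = 0 := by
    rw [Set.image_singleton, euclideanHausdorffMeasure_singleton _ two_pos]
  rw [measure_sdiff_null (measure_singleton 0), Set.image_sdiff (injective_coneMap R α),
    measure_sdiff_null hapex] at harea
  exact harea

/-- The projection to the horizontal plane of the part of the cone over the half-plane `0 ≤ y` that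
is cut out by two planes through the `y`-axis; the boundary arcs are conics of eccentricity `e`
with focus at the origin. -/
def conicSector (R e : ℝ) : Set ℂ :=
  {z | 0 ≤ z.im ∧ ‖z‖ + e * |z.re| ≤ R}

lemma setLIntegral_Ioc_ofReal {c : ℝ} (hc : 0 ≤ c) :
    ∫⁻ r in Set.Ioc 0 c, ENNReal.ofReal r = ENNReal.ofReal (c ^ 2 / 2) := by
  have hint : IntegrableOn (fun r : ℝ ↦ r) (Set.Ioc 0 c) :=
    continuous_id.integrableOn_Icc.mono_set Set.Ioc_subset_Icc_self
  rw [← ofReal_integral_eq_lintegral_ofReal hint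
      ((ae_restrict_mem measurableSet_Ioc).mono fun r hr ↦ hr.1.le),
    ← intervalIntegral.integral_of_le hc, integral_id]
  simp

lemma polarCoord_symm_mem_setOf_norm_le_arg_iff (ρ : ℝ → ℝ) {r θ : ℝ} (hr : 0 < r)
    (hθ : θ ∈ Set.Ioo (-π) π) :
    Complex.polarCoord.symm (r, θ) ∈ {z : ℂ | ‖z‖ ≤ ρ z.arg} ↔ r ≤ ρ θ := by
  have harg : (Complex.polarCoord.symm (r, θ)).arg = θ := by
    rw [Complex.polarCoord_symm_apply, Complex.ofReal_cos, Complex.ofReal_sin,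
      Complex.arg_mul_cos_add_sin_mul_I hr ⟨hθ.1, hθ.2.le⟩]
  rw [Set.mem_ofPred_eq, harg, Complex.norm_polarCoord_symm, abs_of_pos hr]

lemma volume_setOf_norm_le_arg {ρ : ℝ → ℝ} (hρ : Measurable ρ) (hρ0 : ∀ θ, 0 ≤ ρ θ) :
    volume {z : ℂ | ‖z‖ ≤ ρ z.arg} = ∫⁻ θ in Set.Ioo (-π) π, ENNReal.ofReal (ρ θ ^ 2 / 2) := by
  have hmeas : MeasurableSet {z : ℂ | ‖z‖ ≤ ρ z.arg} :=
    measurableSet_le measurable_norm (hρ.comp Complex.measurable_arg)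
  have hpolar : ∀ θ ∈ Set.Ioo (-π) π, ∀ r ∈ Set.Ioi (0 : ℝ),
      ENNReal.ofReal r • {z : ℂ | ‖z‖ ≤ ρ z.arg}.indicator 1 (Complex.polarCoord.symm (r, θ)) =
        (Set.Iic (ρ θ)).indicator ENNReal.ofReal r := fun θ hθ r hr ↦ by
    have hmem := polarCoord_symm_mem_setOf_norm_le_arg_iff ρ hr hθ
    by_cases hr' : r ≤ ρ θ
    · rw [Set.indicator_of_mem (Set.mem_Iic.2 hr'), Set.indicator_of_mem (hmem.2 hr'),
        Pi.one_apply, smul_eq_mul, mul_one]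
    · rw [Set.indicator_of_notMem (hmem.not.2 hr'), smul_zero,
        Set.indicator_of_notMem (Set.mem_Iic.not.2 hr')]
  rw [← lintegral_indicator_one hmeas, ← Complex.lintegral_comp_polarCoord_symm,
    polarCoord_target, Measure.volume_eq_prod, setLIntegral_prod_symm]
  · refine setLIntegral_congr_fun measurableSet_Ioo fun θ hθ ↦ ?_
    rw [setLIntegral_congr_fun measurableSet_Ioi (hpolar θ hθ),
      lintegral_indicator measurableSet_Iic, Measure.restrict_restrict measurableSet_Iic,
      Set.inter_comm, Set.Ioi_inter_Iic, setLIntegral_Ioc_ofReal (hρ0 θ)]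
  · have hsymm : Measurable Complex.polarCoord.symm :=
      Complex.measurableEquivRealProd.symm.measurable.comp continuous_polarCoord_symm.measurable
    exact (measurable_fst.ennreal_ofReal.smul
      ((measurable_one.indicator hmeas).comp hsymm)).aemeasurable

lemma integral_comp_abs_cos (f : ℝ → ℝ) :
    ∫ θ in (0 : ℝ)..π, f |cos θ| = ∫ θ in (-(π / 2))..(π / 2), f (cos θ) := by
  have hperiodic : Function.Periodic (fun θ ↦ f |cos θ|) π := fun θ ↦ by simp [cos_add_pi]
  have hshift := hperiodic.intervalIntegral_add_eq 0 (-(π / 2))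
  rw [zero_add, show -(π / 2) + π = π / 2 by ring] at hshift
  rw [hshift]
  refine intervalIntegral.integral_congr fun θ hθ ↦ ?_
  rw [Set.uIcc_of_le (by linarith [pi_pos])] at hθ
  simp only [abs_of_nonneg (cos_nonneg_of_mem_Icc hθ)]

lemma conicSector_eq_setOf_norm_le_arg (R : ℝ) {e : ℝ} (he : 0 ≤ e) :
    conicSector R e =
      {z | ‖z‖ ≤ (Set.Ici 0).indicator (fun θ ↦ R / (1 + e * |cos θ|)) z.arg} := by
  ext z
  have hpos : 0 < 1 + e * |cos z.arg| := by positivity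
  have hre : ‖z‖ + e * |z.re| = ‖z‖ * (1 + e * |cos z.arg|) := by
    rw [← Complex.norm_mul_cos_arg z, abs_mul, abs_norm]
    ring
  by_cases harg : 0 ≤ z.arg
  · simp [conicSector, harg, Complex.arg_nonneg_iff.1 harg, hre, le_div_iff₀ hpos]
  · have hz : z ≠ 0 := by
      rintro rfl
      simp at harg
    simp [conicSector, harg, hz, Complex.arg_nonneg_iff.not.1 harg]

lemma setLIntegral_Ioo_neg_pi_pi_indicator_Ici (f : ℝ → ENNReal) :
    ∫⁻ θ in Set.Ioo (-π) π, (Set.Ici 0).indicator f θ = ∫⁻ θ in Set.Ioc 0 π, f θ := by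
  have hinter : Set.Ici 0 ∩ Set.Ioo (-π) π = Set.Ico 0 π := by
    ext θ
    simp only [Set.mem_inter_iff, Set.mem_Ici, Set.mem_Ioo, Set.mem_Ico]
    grind [pi_pos]
  rw [lintegral_indicator measurableSet_Ici, Measure.restrict_restrict measurableSet_Ici, hinter,
    restrict_Ico_eq_restrict_Ioc]

lemma volume_conicSector {R e : ℝ} (hR : 0 ≤ R) (he : 0 ≤ e) :
    volume (conicSector R e) =
      ENNReal.ofReal (R ^ 2 / 2 * ∫ θ in (-(π / 2))..(π / 2), 1 / (1 + e * cos θ) ^ 2) := by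
  have hpos (θ : ℝ) : 0 < 1 + e * |cos θ| := by positivity
  have hmeas : Measurable fun θ ↦ R / (1 + e * |cos θ|) := by fun_prop
  have hint : IntervalIntegrable (fun θ ↦ R ^ 2 / 2 * (1 / (1 + e * |cos θ|) ^ 2)) volume 0 π :=
    Continuous.intervalIntegrable (by fun_prop (disch := exact fun θ ↦ by positivity)) 0 π
  have hsq (θ : ℝ) : ENNReal.ofReal
      ((Set.Ici 0).indicator (fun θ ↦ R / (1 + e * |cos θ|)) θ ^ 2 / 2) =
        (Set.Ici 0).indicator
          (fun θ ↦ ENNReal.ofReal (R ^ 2 / 2 * (1 / (1 + e * |cos θ|) ^ 2))) θ := by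
    by_cases hθ : 0 ≤ θ
    · rw [Set.indicator_of_mem (Set.mem_Ici.2 hθ), Set.indicator_of_mem (Set.mem_Ici.2 hθ)]
      congr 1
      field_simp
    · simp [hθ]
  rw [conicSector_eq_setOf_norm_le_arg R he,
    volume_setOf_norm_le_arg (hmeas.indicator measurableSet_Ici)
      (Set.indicator_nonneg fun θ _ ↦ div_nonneg hR (hpos θ).le)]
  simp only [hsq]
  rw [setLIntegral_Ioo_neg_pi_pi_indicator_Ici,
    ← ofReal_integral_eq_lintegral_ofReal hint.1 (ae_of_all _ fun θ ↦ by positivity),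
    ← intervalIntegral.integral_of_le pi_pos.le, intervalIntegral.integral_const_mul,
    integral_comp_abs_cos fun x ↦ 1 / (1 + e * x) ^ 2]

/-! ### Rotations about the `y`-axis and wedges -/

@[simp] lemma rotY_apply_zero (φ : ℝ) (p : E³) : rotY φ p 0 = cos φ * p 0 + sin φ * p 2 := rfl

@[simp] lemma rotY_apply_one (φ : ℝ) (p : E³) : rotY φ p 1 = p 1 := rfl

@[simp] lemma rotY_apply_two (φ : ℝ) (p : E³) : rotY φ p 2 = -sin φ * p 0 + cos φ * p 2 := rfl

lemma euclideanSpace_ext_three {p q : E³} (h0 : p 0 = q 0) (h1 : p 1 = q 1) (h2 : p 2 = q 2) :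
    p = q := by
  ext i
  fin_cases i <;> assumption

@[simp] lemma rotY_zero (p : E³) : rotY 0 p = p :=
  euclideanSpace_ext_three (by simp) (by simp) (by simp)

lemma rotY_rotY (φ ψ : ℝ) (p : E³) : rotY φ (rotY ψ p) = rotY (φ + ψ) p := by
  refine euclideanSpace_ext_three ?_ rfl ?_ <;>
  · simp only [rotY_apply_zero, rotY_apply_two, cos_add, sin_add]
    ring

lemma rotY_comm (φ ψ : ℝ) (p : E³) : rotY φ (rotY ψ p) = rotY ψ (rotY φ p) := by
  rw [rotY_rotY, rotY_rotY, add_comm]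

lemma rotY_int_mul_two_pi (m : ℤ) (p : E³) : rotY (m * (2 * π)) p = p := by
  have hsin : sin (m * (2 * π)) = 0 := by simpa using sin_add_int_mul_two_pi 0 m
  exact euclideanSpace_ext_three (by simp [hsin]) rfl (by simp [hsin])

lemma rotY_smul (φ t : ℝ) (p : E³) : rotY φ (t • p) = t • rotY φ p := by
  refine euclideanSpace_ext_three ?_ rfl ?_ <;>
  · simp only [rotY_apply_zero, rotY_apply_two, PiLp.smul_apply, smul_eq_mul]
    ring

lemma isometry_rotY (φ : ℝ) : Isometry (rotY φ) := by
  refine Isometry.of_dist_eq fun p q ↦ ?_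
  rw [EuclideanSpace.dist_eq, EuclideanSpace.dist_eq, Fin.sum_univ_three, Fin.sum_univ_three]
  congr 1
  simp only [rotY_apply_zero, rotY_apply_one, rotY_apply_two, Real.dist_eq, sq_abs]
  linear_combination ((p 0 - q 0) ^ 2 + (p 2 - q 2) ^ 2) * sin_sq_add_cos_sq φ

lemma norm_rotY (φ : ℝ) (p : E³) : ‖rotY φ p‖ = ‖p‖ := by
  have h := (isometry_rotY φ).dist_eq p 0
  rwa [show rotY φ 0 = 0 by simpa using rotY_smul φ 0 0, dist_zero_right, dist_zero_right] at h

lemma image_rotY (φ : ℝ) (s : Set E³) : rotY φ '' s = rotY (-φ) ⁻¹' s :=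
  congrFun (Set.image_eq_preimage_of_inverse (fun p ↦ by simp [rotY_rotY])
    fun p ↦ by simp [rotY_rotY]) s

lemma exists_polar_rotY (p : E³) :
    ∃ r ψ, 0 ≤ r ∧ ∀ φ, rotY φ p 0 = r * sin (ψ + φ) ∧ rotY φ p 2 = r * cos (ψ + φ) := by
  set w : ℂ := ⟨p 2, p 0⟩
  have hcos : ‖w‖ * cos w.arg = p 2 := Complex.norm_mul_cos_arg w
  have hsin : ‖w‖ * sin w.arg = p 0 := Complex.norm_mul_sin_arg w
  refine ⟨‖w‖, w.arg, norm_nonneg w, fun φ ↦ ?_⟩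
  rw [rotY_apply_zero, rotY_apply_two, ← hcos, ← hsin, sin_add, cos_add]
  constructor <;> ring

lemma exists_fin_rotY_iff_exists_int {n : ℕ} (hn : 0 < n) {P : E³ → Prop} {p : E³} :
    (∃ k : Fin n, P (rotY (-(2 * π * (k : ℕ) / n)) p)) ↔
      ∃ j : ℤ, P (rotY (j * (2 * π / n)) p) := by
  have hn' : (0 : ℤ) < n := by exact_mod_cast hn
  constructor
  · rintro ⟨k, hk⟩
    refine ⟨-(k : ℕ), ?_⟩
    convert hk using 2
    push_cast
    ring
  · rintro ⟨j, hj⟩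
    refine ⟨⟨(-j % n).toNat, by have := Int.emod_lt_of_pos (-j) hn'; omega⟩, ?_⟩
    have hmod : (((-j % n).toNat : ℕ) : ℝ) = -j - n * ((-j / n : ℤ) : ℝ) := by
      rw [← Int.cast_natCast, Int.toNat_of_nonneg (Int.emod_nonneg _ hn'.ne'), Int.emod_def]
      push_cast
      ring
    rw [← rotY_int_mul_two_pi (-j / n) p, rotY_rotY] at hj
    convert hj using 2
    rw [hmod]
    field_simp
    ring

/-- The reflection in the plane `y = 0`. -/
noncomputable def reflY (p : E³) : E³ := !₂[p 0, -p 1, p 2]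

lemma isometry_reflY : Isometry reflY := by
  refine Isometry.of_dist_eq fun p q ↦ ?_
  rw [EuclideanSpace.dist_eq, EuclideanSpace.dist_eq, Fin.sum_univ_three, Fin.sum_univ_three]
  simp only [Real.dist_eq, sq_abs]
  congr 1
  change (p 0 - q 0) ^ 2 + (-p 1 - -q 1) ^ 2 + (p 2 - q 2) ^ 2 = _
  ring

lemma reflY_reflY (p : E³) : reflY (reflY p) = p :=
  euclideanSpace_ext_three rfl (neg_neg _) rfl

lemma image_reflY (s : Set E³) : reflY '' s = reflY ⁻¹' s :=
  congrFun (Set.image_eq_preimage_of_inverse reflY_reflY reflY_reflY) s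

lemma norm_reflY (p : E³) : ‖reflY p‖ = ‖p‖ := by
  have h0 : reflY 0 = 0 := euclideanSpace_ext_three rfl neg_zero rfl
  have h := isometry_reflY.dist_eq p 0
  rwa [h0, dist_zero_right, dist_zero_right] at h

/-- The wedge of half-angle `β` around the upper half of the `z`-axis, with edge the `y`-axis. -/
def yWedge (β : ℝ) : Set E³ :=
  {p | |p 0| * cos β ≤ p 2 * sin β}

lemma mem_yWedge_iff {β : ℝ} {p : E³} : p ∈ yWedge β ↔ |p 0| * cos β ≤ p 2 * sin β := Iff.rfl

lemma mem_yWedge_of_polar {β r x : ℝ} {p : E³} (hr : 0 ≤ r) (hβ : β ≤ π) (hx : |x| ≤ β)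
    (hp : p 0 = r * sin x ∧ p 2 = r * cos x) : p ∈ yWedge β := by
  have hsin : 0 ≤ sin (β - |x|) :=
    sin_nonneg_of_nonneg_of_le_pi (by linarith) (by linarith [abs_nonneg x])
  rw [sin_sub, cos_abs, ← abs_sin_eq_sin_abs_of_abs_le_pi (hx.trans hβ)] at hsin
  rw [mem_yWedge_iff, hp.1, hp.2, abs_mul, abs_of_nonneg hr, mul_assoc, mul_assoc]
  exact mul_le_mul_of_nonneg_left (by linarith) hr

lemma exists_int_polar_rotY {n : ℕ} (hn : 0 < n) (p : E³) :
    ∃ (j : ℤ) (r ψ : ℝ), 0 ≤ r ∧ |ψ| ≤ π / n ∧ ∀ φ,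
      rotY φ (rotY (j * (2 * π / n)) p) 0 = r * sin (ψ + φ) ∧
        rotY φ (rotY (j * (2 * π / n)) p) 2 = r * cos (ψ + φ) := by
  obtain ⟨r, ψ, hr, hpolar⟩ := exists_polar_rotY p
  have hstep : (0 : ℝ) < 2 * π / n := by positivity
  refine ⟨-round (ψ / (2 * π / n)), r, ψ - round (ψ / (2 * π / n)) * (2 * π / n), hr, ?_,
    fun φ ↦ ?_⟩
  · calc |ψ - round (ψ / (2 * π / n)) * (2 * π / n)|
        = |ψ / (2 * π / n) - round (ψ / (2 * π / n))| * (2 * π / n) := by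
          rw [← abs_of_pos hstep, ← abs_mul, abs_of_pos hstep, sub_mul,
            div_mul_cancel₀ _ hstep.ne']
      _ ≤ 1 / 2 * (2 * π / n) := by
          gcongr
          exact abs_sub_round _
      _ = π / n := by ring
  · rw [rotY_rotY]
    convert hpolar _ using 4 <;>
    · push_cast
      ring

lemma exists_int_rotY_mem_yWedge {n : ℕ} (hn : 0 < n) (p : E³) :
    ∃ j : ℤ, rotY (j * (2 * π / n)) p ∈ yWedge (π / n) := by
  obtain ⟨j, r, ψ, hr, hψ, hpolar⟩ := exists_int_polar_rotY hn p
  have hp := hpolar 0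
  rw [rotY_zero, add_zero] at hp
  exact ⟨j, mem_yWedge_of_polar hr (div_le_self pi_pos.le (by exact_mod_cast hn)) hψ hp⟩

lemma apply_two_sub_rotY (γ : ℝ) (p : E³) :
    p 2 - rotY (2 * γ) p 2 = 2 * (p 2 * sin γ ^ 2 + p 0 * (sin γ * cos γ)) := by
  rw [rotY_apply_two, sin_two_mul, cos_two_mul']
  linear_combination -p 2 * sin_sq_add_cos_sq γ

lemma apply_two_nonneg_of_mem_yWedge {β : ℝ} (hsin : 0 < sin β) (hcos : 0 ≤ cos β) {p : E³}
    (hp : p ∈ yWedge β) : 0 ≤ p 2 :=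
  nonneg_of_mul_nonneg_left ((mul_nonneg (abs_nonneg _) hcos).trans hp) hsin

lemma le_apply_two_sub_rotY_of_mem_yWedge {β γ : ℝ} (hβ : 0 < sin β) (hγ : |cos γ| ≤ cos β)
    {p : E³} (hp : p ∈ yWedge β) :
    2 * sin β * (p 2 * sin β - |p 0| * cos β) ≤ p 2 - rotY (2 * γ) p 2 := by
  have hp2 := apply_two_nonneg_of_mem_yWedge hβ ((abs_nonneg _).trans hγ) hp
  rw [mem_yWedge_iff] at hp
  have hsin : sin β ≤ |sin γ| := by
    refine le_of_sq_le_sq ?_ (abs_nonneg _)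
    have := pow_le_pow_left₀ (abs_nonneg _) hγ 2
    rw [sq_abs] at this ⊢
    linarith [sin_sq_add_cos_sq γ, sin_sq_add_cos_sq β]
  calc 2 * sin β * (p 2 * sin β - |p 0| * cos β)
      ≤ 2 * |sin γ| * (p 2 * |sin γ| - |p 0| * |cos γ|) := by
        have : 0 ≤ p 2 * sin β - |p 0| * cos β := by linarith
        gcongr
    _ = 2 * (p 2 * sin γ ^ 2 - |p 0 * (sin γ * cos γ)|) := by
        rw [abs_mul, abs_mul, ← sq_abs (sin γ)]
        ring
    _ ≤ 2 * (p 2 * sin γ ^ 2 + p 0 * (sin γ * cos γ)) := by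
        linarith [neg_abs_le (p 0 * (sin γ * cos γ))]
    _ = p 2 - rotY (2 * γ) p 2 := (apply_two_sub_rotY γ p).symm

lemma abs_cos_le_cos {β x : ℝ} (hβ : 0 ≤ β) (hle : β ≤ x) (hge : x ≤ π - β) : |cos x| ≤ cos β :=
  abs_le'.2 ⟨cos_le_cos_of_nonneg_of_le_pi hβ (by linarith) hle,
    cos_pi_sub x ▸ cos_le_cos_of_nonneg_of_le_pi hβ (by linarith) (by linarith)⟩

lemma abs_cos_int_mul_pi_div_le {n : ℕ} (hn : 0 < n) {j : ℤ} (hj : ¬ (n : ℤ) ∣ j) :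
    |cos (j * (π / n))| ≤ cos (π / n) := by
  have hn' : (0 : ℤ) < n := by exact_mod_cast hn
  have hlo : 1 ≤ j % n := by
    have := Int.emod_nonneg j hn'.ne'
    have := mt Int.dvd_of_emod_eq_zero hj
    omega
  have hhi : j % n + 1 ≤ n := by
    have := Int.emod_lt_of_pos j hn'
    omega
  have hlo' : (1 : ℝ) ≤ (j % n : ℤ) := by exact_mod_cast hlo
  have hhi' : ((j % n : ℤ) : ℝ) + 1 ≤ n := by exact_mod_cast hhi
  have hangle : j * (π / n) = (j % n : ℤ) * (π / n) + (j / n : ℤ) * π := by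
    have : (j : ℝ) = (j % n : ℤ) + n * (j / n : ℤ) := by
      exact_mod_cast (Int.emod_add_mul_ediv j n).symm
    rw [this]
    field_simp
  have hstep : (0 : ℝ) ≤ π / n := by positivity
  have hpi : (n : ℝ) * (π / n) = π := by field_simp
  rw [hangle, cos_add_int_mul_pi, abs_mul, abs_zpow, abs_neg, abs_one, one_zpow, one_mul]
  exact abs_cos_le_cos hstep (by nlinarith) (by nlinarith)

lemma pi_div_mem_Ioc {n : ℕ} (hn : 2 ≤ n) : π / n ∈ Set.Ioc 0 (π / 2) := by
  have : (2 : ℝ) ≤ n := by exact_mod_cast hn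
  exact ⟨by positivity, by gcongr⟩

lemma sin_pi_div_pos {n : ℕ} (hn : 2 ≤ n) : 0 < sin (π / n) :=
  sin_pos_of_pos_of_lt_pi (pi_div_mem_Ioc hn).1 (by linarith [(pi_div_mem_Ioc hn).2, pi_pos])

lemma cos_pi_div_nonneg {n : ℕ} (hn : 2 ≤ n) : 0 ≤ cos (π / n) :=
  cos_nonneg_of_mem_Icc ⟨by linarith [(pi_div_mem_Ioc hn).1, pi_pos], (pi_div_mem_Ioc hn).2⟩

lemma le_sub_rotY_int_mul_of_mem_yWedge {n : ℕ} (hn : 2 ≤ n) {p : E³}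
    (hp : p ∈ yWedge (π / n)) {j : ℤ} (hj : ¬ (n : ℤ) ∣ j) :
    2 * sin (π / n) * (p 2 * sin (π / n) - |p 0| * cos (π / n)) ≤
      p 2 - rotY (j * (2 * π / n)) p 2 := by
  rw [show j * (2 * π / n) = 2 * (j * (π / n)) by ring]
  exact le_apply_two_sub_rotY_of_mem_yWedge (sin_pi_div_pos hn)
    (abs_cos_int_mul_pi_div_le (by omega) hj) hp

lemma rotY_int_mul_of_dvd {n : ℕ} (hn : 0 < n) {j : ℤ} (hj : (n : ℤ) ∣ j) (p : E³) :
    rotY (j * (2 * π / n)) p = p := by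
  obtain ⟨m, rfl⟩ := hj
  have : ((n * m : ℤ) : ℝ) * (2 * π / n) = m * (2 * π) := by
    push_cast
    field_simp
  rw [this, rotY_int_mul_two_pi]

lemma rotY_int_mul_apply_two_le {n : ℕ} (hn : 2 ≤ n) {p : E³} (hp : p ∈ yWedge (π / n)) (j : ℤ) :
    rotY (j * (2 * π / n)) p 2 ≤ p 2 := by
  by_cases hj : (n : ℤ) ∣ j
  · rw [rotY_int_mul_of_dvd (by omega) hj]
  · refine sub_nonneg.1 (le_trans ?_ (le_sub_rotY_int_mul_of_mem_yWedge hn hp hj))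
    exact mul_nonneg (by linarith [sin_pi_div_pos hn]) (sub_nonneg.2 hp)

lemma abs_mul_cos_eq_of_rotY_mem_yWedge {n : ℕ} (hn : 2 ≤ n) {p : E³} (hp : p ∈ yWedge (π / n))
    {j : ℤ} (hj : ¬ (n : ℤ) ∣ j) (hpj : rotY (j * (2 * π / n)) p ∈ yWedge (π / n)) :
    |p 0| * cos (π / n) = p 2 * sin (π / n) := by
  have hback := rotY_int_mul_apply_two_le hn hpj (-j)
  rw [rotY_rotY, Int.cast_neg, neg_mul, neg_add_cancel, rotY_zero] at hback
  have hle := le_sub_rotY_int_mul_of_mem_yWedge hn hp hj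
  refine le_antisymm hp (sub_nonpos.1 (nonpos_of_mul_nonpos_right (hle.trans ?_) ?_))
  · linarith
  · linarith [sin_pi_div_pos hn]

/-! ### The spindle as a sublevel set -/

lemma bddAbove_range_rotY_apply_two {ι : Type*} (φ : ι → ℝ) (p : E³) :
    BddAbove (Set.range fun k ↦ rotY (φ k) p 2) :=
  ⟨‖p‖, Set.forall_mem_range.2 fun _ ↦
    norm_rotY _ p ▸ (le_abs_self _).trans (PiLp.norm_apply_le (rotY _ p) 2)⟩

/-- The largest of the `z`-coordinates of the `n` images of `p` under the rotations about the
`y`-axis through multiples of `2π / n`. -/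
noncomputable def spindleHeight (n : ℕ) (p : E³) : ℝ :=
  ⨆ k : ℤ, rotY (k * (2 * π / n)) p 2

lemma spindleHeight_rotY (n : ℕ) (j : ℤ) (p : E³) :
    spindleHeight n (rotY (j * (2 * π / n)) p) = spindleHeight n p := by
  rw [spindleHeight, spindleHeight,
    ← (Equiv.addRight j).iSup_comp (g := fun k : ℤ ↦ rotY (k * (2 * π / n)) p 2)]
  refine iSup_congr fun k ↦ ?_
  rw [rotY_rotY, Equiv.coe_addRight, Int.cast_add, add_mul]

lemma spindleHeight_smul (n : ℕ) {t : ℝ} (ht : 0 ≤ t) (p : E³) :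
    spindleHeight n (t • p) = t * spindleHeight n p := by
  simp only [spindleHeight, Real.mul_iSup_of_nonneg ht, rotY_smul, PiLp.smul_apply, smul_eq_mul]

lemma continuous_spindleHeight (n : ℕ) : Continuous (spindleHeight n) := by
  refine (LipschitzWith.of_le_add fun p q ↦ ciSup_le fun k ↦ ?_).continuous
  have hdist : rotY (k * (2 * π / n)) p 2 - rotY (k * (2 * π / n)) q 2 ≤ dist p q := by
    rw [← (isometry_rotY (k * (2 * π / n))).dist_eq, dist_eq_norm]
    exact (le_abs_self _).trans
      (PiLp.norm_apply_le (rotY (k * (2 * π / n)) p - rotY (k * (2 * π / n)) q) 2)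
  have hle : rotY (k * (2 * π / n)) q 2 ≤ spindleHeight n q :=
    le_ciSup (bddAbove_range_rotY_apply_two (fun k : ℤ ↦ k * (2 * π / n)) q) k
  change _ ≤ spindleHeight n q + dist p q
  linarith

lemma spindleHeight_of_mem_yWedge {n : ℕ} (hn : 2 ≤ n) {p : E³} (hp : p ∈ yWedge (π / n)) :
    spindleHeight n p = p 2 := by
  refine le_antisymm (ciSup_le (rotY_int_mul_apply_two_le hn hp)) ?_
  have h := le_ciSup (bddAbove_range_rotY_apply_two (fun k : ℤ ↦ k * (2 * π / n)) p) 0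
  rwa [Int.cast_zero, zero_mul, rotY_zero] at h

/-- The function on space, positively homogeneous of degree one, whose sublevel sets are the
spindles with centre at the origin. On the wedge around the upper half of the `z`-axis it is the
function `z cos α + √(x² + y²) sin α` with `α = π / (2 n)`, whose level sets are cones of
slope `α`. -/
noncomputable def spindleGauge (n : ℕ) (p : E³) : ℝ :=
  spindleHeight n p * cos (π / (2 * n)) + √(‖p‖ ^ 2 - spindleHeight n p ^ 2) * sin (π / (2 * n))

lemma spindleGauge_rotY_int_mul (n : ℕ) (j : ℤ) (p : E³) :
    spindleGauge n (rotY (j * (2 * π / n)) p) = spindleGauge n p := by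
  rw [spindleGauge, spindleHeight_rotY, norm_rotY, spindleGauge]

lemma spindleGauge_reflY (n : ℕ) (p : E³) : spindleGauge n (reflY p) = spindleGauge n p := by
  have h : spindleHeight n (reflY p) = spindleHeight n p := rfl
  rw [spindleGauge, h, norm_reflY, spindleGauge]

lemma spindleGauge_smul (n : ℕ) {t : ℝ} (ht : 0 ≤ t) (p : E³) :
    spindleGauge n (t • p) = t * spindleGauge n p := by
  rw [spindleGauge, spindleHeight_smul n ht, norm_smul, mul_pow, mul_pow,
    Real.norm_eq_abs, sq_abs, ← mul_sub, sqrt_mul (sq_nonneg t), sqrt_sq ht, spindleGauge]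
  ring

lemma continuous_spindleGauge (n : ℕ) : Continuous (spindleGauge n) := by
  have := continuous_spindleHeight n
  unfold spindleGauge
  fun_prop

lemma spindleGauge_of_mem_yWedge {n : ℕ} (hn : 2 ≤ n) {p : E³} (hp : p ∈ yWedge (π / n)) :
    spindleGauge n p =
      p 2 * cos (π / (2 * n)) + √(p 0 ^ 2 + p 1 ^ 2) * sin (π / (2 * n)) := by
  rw [spindleGauge, spindleHeight_of_mem_yWedge hn hp, EuclideanSpace.norm_sq_eq,
    Fin.sum_univ_three]
  simp only [Real.norm_eq_abs, sq_abs, add_sub_cancel_right]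

lemma spindleHeight_of_polar {n : ℕ} (hn : 2 ≤ n) {p : E³} {r x : ℝ} (hr : 0 ≤ r)
    (hx : |x| ≤ π / n) (hp : p 0 = r * sin x ∧ p 2 = r * cos x) :
    spindleHeight n p = r * cos x := by
  have hπ : π / n ≤ π := (pi_div_mem_Ioc hn).2.trans (by linarith [pi_pos])
  rw [spindleHeight_of_mem_yWedge hn (mem_yWedge_of_polar hr hπ hx hp), hp.2]

lemma spindleGauge_of_polar {n : ℕ} (hn : 2 ≤ n) {p : E³} {r x : ℝ} (hr : 0 ≤ r)
    (hx : |x| ≤ π / n) (hp : p 0 = r * sin x ∧ p 2 = r * cos x) (hp1 : p 1 = 0) :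
    spindleGauge n p = r * cos (|x| - π / (2 * n)) := by
  have hπ : π / n ≤ π := (pi_div_mem_Ioc hn).2.trans (by linarith [pi_pos])
  rw [spindleGauge_of_mem_yWedge hn (mem_yWedge_of_polar hr hπ hx hp), hp1, hp.1, hp.2,
    zero_pow two_ne_zero, add_zero, sqrt_sq_eq_abs, abs_mul, abs_of_nonneg hr, cos_sub, cos_abs,
    ← abs_sin_eq_sin_abs_of_abs_le_pi (hx.trans hπ)]
  ring

-- The plane `y = 0` meets the spindle in a regular `2n`-gon.
lemma spindleGauge_eq_spindleHeight_two_mul {n : ℕ} (hn : 2 ≤ n) {p : E³} (hp : p 1 = 0) :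
    spindleGauge n p = spindleHeight (2 * n) (rotY (π / (2 * n)) p) := by
  obtain ⟨j, r, x, hr, hx, hpolar⟩ := exists_int_polar_rotY (by omega : 0 < n) p
  set q := rotY (j * (2 * π / n)) p with hq
  have hpolar0 := hpolar 0
  rw [rotY_zero, add_zero] at hpolar0
  have hn0 : (n : ℝ) ≠ 0 := by positivity
  have hstep : j * (2 * π / n) = (2 * j : ℤ) * (2 * π / (2 * n : ℕ)) := by
    push_cast
    field_simp
  have hback : -(π / (2 * n)) = (-1 : ℤ) * (2 * π / (2 * n : ℕ)) + π / (2 * n) := by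
    push_cast
    field_simp
    ring
  rw [← spindleHeight_rotY (2 * n) (2 * j), rotY_comm, ← hstep, ← spindleGauge_rotY_int_mul n j,
    ← hq, spindleGauge_of_polar hn hr hx hpolar0 hp]
  have hheight (φ : ℝ) (hφ : |x + φ| ≤ π / (2 * n)) :
      spindleHeight (2 * n) (rotY φ q) = r * cos (x + φ) :=
    spindleHeight_of_polar (by omega) hr (by push_cast; exact hφ) (hpolar φ)
  have hhalf : π / n = 2 * (π / (2 * n)) := by field_simp
  rw [hhalf, abs_le] at hx
  rcases le_total 0 x with h | h
  · rw [← spindleHeight_rotY (2 * n) (-1), rotY_rotY, ← hback, abs_of_nonneg h,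
      hheight _ (abs_le.2 ⟨by linarith, by linarith⟩), sub_eq_add_neg]
  · rw [hheight _ (abs_le.2 ⟨by linarith, by linarith⟩), abs_of_nonpos h, ← cos_neg]
    ring_nf

lemma spindleGauge_rotY_pi_div {n : ℕ} (hn : 2 ≤ n) {p : E³} (hp : p 1 = 0) :
    spindleGauge n (rotY (-(π / n)) p) = spindleGauge n p := by
  have hstep : -(π / n) = (-1 : ℤ) * (2 * π / (2 * n : ℕ)) := by
    push_cast
    field_simp
  have hp' : rotY (-(π / n)) p 1 = 0 := hp
  rw [spindleGauge_eq_spindleHeight_two_mul hn hp, spindleGauge_eq_spindleHeight_two_mul hn hp',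
    rotY_comm, hstep, spindleHeight_rotY]

lemma cos_pi_div_two_mul_pos {n : ℕ} (hn : 2 ≤ n) : 0 < cos (π / (2 * n)) := by
  obtain ⟨hpos, hle⟩ := pi_div_mem_Ioc hn
  rw [show π / (2 * n) = π / n / 2 by ring]
  exact cos_pos_of_mem_Ioo ⟨by linarith, by linarith [pi_pos]⟩

lemma sin_pi_div_two_mul_pos {n : ℕ} (hn : 2 ≤ n) : 0 < sin (π / (2 * n)) := by
  exact_mod_cast sin_pi_div_pos (n := 2 * n) (by omega)

lemma le_mul_tan_iff {α x y : ℝ} (hα : 0 < cos α) : x ≤ y * tan α ↔ x * cos α ≤ y * sin α := by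
  rw [tan_eq_sin_div_cos, ← mul_div_assoc, le_div_iff₀ hα]

lemma mem_conePiece_iff {n : ℕ} (hn : 2 ≤ n) {R : ℝ} {p : E³} :
    p ∈ conePiece n R ↔ p ∈ yWedge (π / n) ∧ spindleGauge n p ≤ R * sin (π / (2 * n)) := by
  have hs := sin_pi_div_pos hn
  have hcut : |p 0| * tan (π / 2 - π / n) ≤ p 2 ↔ p ∈ yWedge (π / n) := by
    rw [tan_pi_div_two_sub, tan_eq_sin_div_cos, inv_div, ← mul_div_assoc, div_le_iff₀ hs,
      mem_yWedge_iff]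
  change ((0 ≤ p 2 ∧ p 2 ≤ (R - √(p 0 ^ 2 + p 1 ^ 2)) * tan (π / (2 * n))) ∧ _) ↔ _
  rw [hcut, le_mul_tan_iff (cos_pi_div_two_mul_pos hn), and_comm]
  refine and_congr_right fun hp ↦ ?_
  rw [and_iff_right (apply_two_nonneg_of_mem_yWedge hs (cos_pi_div_nonneg hn) hp),
    spindleGauge_of_mem_yWedge hn hp, sub_mul, le_sub_iff_add_le]

lemma mem_spindle_iff {n : ℕ} (hn : 2 ≤ n) {R : ℝ} {p : E³} :
    p ∈ spindle n R ↔ spindleGauge n p ≤ R * sin (π / (2 * n)) := by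
  simp only [spindle, Set.mem_iUnion, image_rotY, Set.mem_preimage]
  rw [exists_fin_rotY_iff_exists_int (by omega)]
  simp only [mem_conePiece_iff hn, spindleGauge_rotY_int_mul, exists_and_right,
    and_iff_right_iff_imp]
  exact fun _ ↦ exists_int_rotY_mem_yWedge (by omega) p

/-! ### The boundary of the `n`-con -/

/-- The function on space, positively homogeneous of degree one, whose sublevel sets are the
`n`-cons with centre at the origin. -/
noncomputable def polyconGauge (n : ℕ) (p : E³) : ℝ :=
  if 0 ≤ p 1 then spindleGauge n p else spindleGauge n (rotY (-(π / n)) p)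

lemma polyconGauge_of_nonneg {n : ℕ} {p : E³} (h : 0 ≤ p 1) :
    polyconGauge n p = spindleGauge n p := if_pos h

lemma polyconGauge_of_nonpos {n : ℕ} (hn : 2 ≤ n) {p : E³} (h : p 1 ≤ 0) :
    polyconGauge n p = spindleGauge n (rotY (-(π / n)) p) := by
  rcases h.lt_or_eq with h | h
  · exact if_neg h.not_ge
  · rw [polyconGauge_of_nonneg h.ge, spindleGauge_rotY_pi_div hn h]

lemma continuous_polyconGauge {n : ℕ} (hn : 2 ≤ n) : Continuous (polyconGauge n) :=
  Continuous.if_le (continuous_spindleGauge n)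
    ((continuous_spindleGauge n).comp (isometry_rotY _).continuous) continuous_const
    (by fun_prop) fun _ hp ↦ (spindleGauge_rotY_pi_div hn hp.symm).symm

lemma polyconGauge_smul (n : ℕ) {t : ℝ} (ht : 0 < t) (p : E³) :
    polyconGauge n (t • p) = t * polyconGauge n p := by
  have hsign : 0 ≤ (t • p) 1 ↔ 0 ≤ p 1 := mul_nonneg_iff_of_pos_left ht
  simp only [polyconGauge, hsign, rotY_smul, spindleGauge_smul n ht.le, mul_ite]

lemma polycon_eq_setOf_polyconGauge_le {n : ℕ} (hn : 2 ≤ n) (R : ℝ) :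
    polycon n R = {p | polyconGauge n p ≤ R * sin (π / (2 * n))} := by
  ext p
  rw [polycon, image_rotY]
  change (p ∈ spindle n R ∧ 0 ≤ p 1) ∨ (rotY (-(π / n)) p ∈ spindle n R ∧ p 1 ≤ 0) ↔
    polyconGauge n p ≤ R * sin (π / (2 * n))
  rw [mem_spindle_iff hn, mem_spindle_iff hn]
  rcases lt_trichotomy (p 1) 0 with h | h | h
  · simp [polyconGauge_of_nonpos hn h.le, h.le, h.not_ge]
  · simp [polyconGauge_of_nonpos hn h.le, h, spindleGauge_rotY_pi_div hn h]
  · simp [polyconGauge_of_nonneg h.le, h.le, h.not_ge]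

lemma frontier_setOf_le_of_homogeneous {E : Type*} [TopologicalSpace E] [AddCommGroup E]
    [Module ℝ E] [ContinuousSMul ℝ E] {f : E → ℝ} (hf : Continuous f)
    (hsmul : ∀ t : ℝ, 0 < t → ∀ x, f (t • x) = t * f x) {c : ℝ} (hc : 0 < c) :
    frontier {x | f x ≤ c} = {x | f x = c} := by
  refine (frontier_le_subset_eq hf continuous_const).antisymm fun x (hx : f x = c) ↦
    ⟨subset_closure hx.le, fun hint ↦ ?_⟩
  have hlim : Filter.Tendsto (fun t : ℝ ↦ t • x) (nhdsWithin 1 (Set.Ioi 1)) (nhds x) := by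
    have : Continuous fun t : ℝ ↦ t • x := by fun_prop
    simpa using (this.tendsto 1).mono_left nhdsWithin_le_nhds
  obtain ⟨t, hle, ht : 1 < t⟩ :=
    ((hlim.eventually (mem_interior_iff_mem_nhds.1 hint)).and self_mem_nhdsWithin).exists
  have hle' : t * c ≤ c := by rw [← hx, ← hsmul t (by linarith)]; exact hle.trans_eq hx.symm
  nlinarith

/-- The half of the boundary of the spindle on which `0 ≤ y`. -/
def spindleHalfBoundary (n : ℕ) (R : ℝ) : Set E³ :=
  {p | spindleGauge n p = R * sin (π / (2 * n)) ∧ 0 ≤ p 1}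

lemma mem_spindleHalfBoundary_iff {n : ℕ} {R : ℝ} {p : E³} :
    p ∈ spindleHalfBoundary n R ↔ spindleGauge n p = R * sin (π / (2 * n)) ∧ 0 ≤ p 1 := Iff.rfl

lemma isClosed_spindleHalfBoundary (n : ℕ) (R : ℝ) : IsClosed (spindleHalfBoundary n R) :=
  (isClosed_eq (continuous_spindleGauge n) continuous_const).inter
    (isClosed_le continuous_const (by fun_prop : Continuous fun p : E³ ↦ p 1))

lemma frontier_polycon {n : ℕ} (hn : 2 ≤ n) {R : ℝ} (hR : 0 < R) :
    frontier (polycon n R) = spindleHalfBoundary n R ∪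
      rotY (π / n) '' (reflY '' spindleHalfBoundary n R) := by
  rw [polycon_eq_setOf_polyconGauge_le hn, frontier_setOf_le_of_homogeneous
    (continuous_polyconGauge hn) (fun t ht ↦ polyconGauge_smul n ht)
    (mul_pos hR (sin_pi_div_two_mul_pos hn))]
  ext p
  have hrefl : reflY (rotY (-(π / n)) p) ∈ spindleHalfBoundary n R ↔
      spindleGauge n (rotY (-(π / n)) p) = R * sin (π / (2 * n)) ∧ p 1 ≤ 0 := by
    rw [mem_spindleHalfBoundary_iff, spindleGauge_reflY]
    exact and_congr_right fun _ ↦ neg_nonneg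
  rw [Set.mem_union, image_rotY, image_reflY, Set.mem_preimage, Set.mem_preimage, hrefl,
    mem_spindleHalfBoundary_iff, Set.mem_ofPred_eq]
  rcases lt_trichotomy (p 1) 0 with h | h | h
  · simp [polyconGauge_of_nonpos hn h.le, h.le, h.not_ge]
  · simp [polyconGauge_of_nonpos hn h.le, h, spindleGauge_rotY_pi_div hn h]
  · simp [polyconGauge_of_nonneg h.le, h.le, h.not_ge]

/-! ### Area of the boundary -/

lemma cos_pi_div_eq_mul_projEccentricity {n : ℕ} (hn : 2 ≤ n) :
    cos (π / n) = tan (π / (2 * n)) * sin (π / n) * projEccentricity n := by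
  have hs := (sin_pi_div_pos hn).ne'
  have hsα := (sin_pi_div_two_mul_pos hn).ne'
  have hcα := (cos_pi_div_two_mul_pos hn).ne'
  rw [projEccentricity, cot_eq_cos_div_sin, cot_eq_cos_div_sin, tan_eq_sin_div_cos]
  generalize π / (2 * (n : ℝ)) = α at *
  field_simp

lemma projEccentricity_nonneg {n : ℕ} (hn : 2 ≤ n) : 0 ≤ projEccentricity n := by
  have hs := sin_pi_div_pos hn
  have hc := cos_pi_div_nonneg hn
  have hsα := sin_pi_div_two_mul_pos hn
  have hcα := cos_pi_div_two_mul_pos hn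
  rw [projEccentricity, cot_eq_cos_div_sin, cot_eq_cos_div_sin]
  positivity

lemma sub_coneMap_eq_mul {n : ℕ} (hn : 2 ≤ n) (R : ℝ) (z : ℂ) :
    coneMap R (π / (2 * n)) z 2 * sin (π / n) - |coneMap R (π / (2 * n)) z 0| * cos (π / n) =
      tan (π / (2 * n)) * sin (π / n) * (R - (‖z‖ + projEccentricity n * |z.re|)) := by
  change (R - ‖z‖) * tan (π / (2 * n)) * sin (π / n) - |z.re| * cos (π / n) = _
  rw [cos_pi_div_eq_mul_projEccentricity hn]
  ring

lemma tan_mul_sin_pos {n : ℕ} (hn : 2 ≤ n) : 0 < tan (π / (2 * n)) * sin (π / n) := by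
  rw [tan_eq_sin_div_cos]
  exact mul_pos (div_pos (sin_pi_div_two_mul_pos hn) (cos_pi_div_two_mul_pos hn))
    (sin_pi_div_pos hn)

lemma coneMap_mem_yWedge_iff {n : ℕ} (hn : 2 ≤ n) {R : ℝ} {z : ℂ} :
    coneMap R (π / (2 * n)) z ∈ yWedge (π / n) ↔ ‖z‖ + projEccentricity n * |z.re| ≤ R := by
  rw [mem_yWedge_iff, ← sub_nonneg, sub_coneMap_eq_mul hn,
    mul_nonneg_iff_of_pos_left (tan_mul_sin_pos hn), sub_nonneg]

lemma spindleGauge_coneMap {n : ℕ} (hn : 2 ≤ n) {R : ℝ} {z : ℂ}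
    (hz : coneMap R (π / (2 * n)) z ∈ yWedge (π / n)) :
    spindleGauge n (coneMap R (π / (2 * n)) z) = R * sin (π / (2 * n)) := by
  rw [spindleGauge_of_mem_yWedge hn hz]
  change (R - ‖z‖) * tan (π / (2 * n)) * _ + √(z.re ^ 2 + z.im ^ 2) * _ = _
  rw [mul_assoc, tan_mul_cos (cos_pi_div_two_mul_pos hn).ne', ← Complex.norm_eq_sqrt_sq_add_sq]
  ring

lemma exists_coneMap_eq {n : ℕ} (hn : 2 ≤ n) {R : ℝ} {p : E³} (hp : p ∈ yWedge (π / n))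
    (hgauge : spindleGauge n p = R * sin (π / (2 * n))) :
    ∃ z : ℂ, z.im = p 1 ∧ coneMap R (π / (2 * n)) z = p := by
  refine ⟨⟨p 0, p 1⟩, rfl, euclideanSpace_ext_three rfl rfl ?_⟩
  rw [spindleGauge_of_mem_yWedge hn hp] at hgauge
  change (R - ‖(⟨p 0, p 1⟩ : ℂ)‖) * tan (π / (2 * n)) = p 2
  rw [Complex.norm_eq_sqrt_sq_add_sq, tan_eq_sin_div_cos, ← mul_div_assoc,
    div_eq_iff (cos_pi_div_two_mul_pos hn).ne']
  linarith

lemma image_coneMap_conicSector {n : ℕ} (hn : 2 ≤ n) (R : ℝ) :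
    coneMap R (π / (2 * n)) '' conicSector R (projEccentricity n) =
      spindleHalfBoundary n R ∩ yWedge (π / n) := by
  ext p
  constructor
  · rintro ⟨z, hz, rfl⟩
    have hwedge := (coneMap_mem_yWedge_iff hn).2 hz.2
    exact ⟨⟨spindleGauge_coneMap hn hwedge, hz.1⟩, hwedge⟩
  · rintro ⟨⟨hgauge, hp1⟩, hp⟩
    obtain ⟨z, him, rfl⟩ := exists_coneMap_eq hn hp hgauge
    exact ⟨z, ⟨him ▸ hp1, (coneMap_mem_yWedge_iff hn).1 hp⟩, rfl⟩

lemma spindleHalfBoundary_eq_iUnion {n : ℕ} (hn : 2 ≤ n) (R : ℝ) :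
    spindleHalfBoundary n R =
      ⋃ k : Fin n, rotY (2 * π * (k : ℕ) / n) '' (spindleHalfBoundary n R ∩ yWedge (π / n)) := by
  ext p
  simp only [Set.mem_iUnion, image_rotY, Set.mem_preimage]
  rw [exists_fin_rotY_iff_exists_int (by omega)]
  simp only [Set.mem_inter_iff, mem_spindleHalfBoundary_iff, spindleGauge_rotY_int_mul,
    rotY_apply_one, exists_and_left]
  rw [and_iff_left (exists_int_rotY_mem_yWedge (by omega) p)]

lemma volume_setOf_norm_add_eq {R e : ℝ} (hR : 0 < R) (he : 0 ≤ e) :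
    volume {z : ℂ | ‖z‖ + e * |z.re| = R} = 0 := by
  have hconv : ConvexOn ℝ Set.univ fun z : ℂ ↦ ‖z‖ + e * |z.re| :=
    convexOn_univ_norm.add ((convexOn_univ_norm.comp_linearMap Complex.reLm).smul he)
  have hhom (t : ℝ) (ht : 0 < t) (z : ℂ) :
      ‖t • z‖ + e * |(t • z).re| = t * (‖z‖ + e * |z.re|) := by
    rw [norm_smul, Complex.smul_re, smul_eq_mul, abs_mul, Real.norm_eq_abs, abs_of_pos ht]
    ring
  rw [← frontier_setOf_le_of_homogeneous (by fun_prop) hhom hR]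
  simpa using (hconv.convex_le R).addHaar_frontier volume

lemma volume_setOf_im_eq_zero : volume {z : ℂ | z.im = 0} = 0 := by
  refine Measure.addHaar_submodule volume (LinearMap.ker Complex.imLm) fun h ↦ ?_
  have : Complex.I ∈ LinearMap.ker Complex.imLm := h ▸ Submodule.mem_top
  simp at this

lemma isClosed_conicSector (R e : ℝ) : IsClosed (conicSector R e) :=
  (isClosed_le continuous_const Complex.continuous_im).inter
    (isClosed_le (by fun_prop : Continuous fun z : ℂ ↦ ‖z‖ + e * |z.re|) continuous_const)

lemma euclideanHausdorffMeasure_sep_mem_edge {n : ℕ} (hn : 2 ≤ n) {R : ℝ} (hR : 0 < R) :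
    μHE[2] {p ∈ spindleHalfBoundary n R | |p 0| * cos (π / n) = p 2 * sin (π / n)} = 0 := by
  have hnull : μHE[2] (coneMap R (π / (2 * n)) ''
      {z | ‖z‖ + projEccentricity n * |z.re| = R}) = 0 := by
    rw [euclideanHausdorffMeasure_image_coneMap R (cos_pi_div_two_mul_pos hn)
      (measurableSet_eq_fun (by fun_prop) (by fun_prop)),
      volume_setOf_norm_add_eq hR (projEccentricity_nonneg hn), mul_zero]
  refine measure_mono_null ?_ hnull
  rintro p ⟨⟨hgauge, -⟩, hedge⟩
  obtain ⟨z, -, rfl⟩ := exists_coneMap_eq hn hedge.le hgauge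
  have hz := sub_coneMap_eq_mul hn R z
  rw [← hedge, sub_self, eq_comm, mul_eq_zero_iff_left (tan_mul_sin_pos hn).ne', sub_eq_zero] at hz
  exact ⟨z, hz.symm, rfl⟩

lemma euclideanHausdorffMeasure_sep_apply_one_eq_zero {n : ℕ} (hn : 2 ≤ n) (R : ℝ) :
    μHE[2] {p ∈ spindleHalfBoundary n R | p 1 = 0} = 0 := by
  have hnull : μHE[2] (coneMap R (π / (2 * n)) '' {z | z.im = 0}) = 0 := by
    rw [euclideanHausdorffMeasure_image_coneMap R (cos_pi_div_two_mul_pos hn)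
      (measurableSet_eq_fun Complex.measurable_im measurable_const), volume_setOf_im_eq_zero,
      mul_zero]
  refine measure_mono_null (t := ⋃ k : Fin n,
    rotY (2 * π * (k : ℕ) / n) '' (coneMap R (π / (2 * n)) '' {z | z.im = 0})) ?_ ?_
  · rintro p ⟨hp, hp1⟩
    rw [spindleHalfBoundary_eq_iUnion hn, Set.mem_iUnion] at hp
    obtain ⟨k, q, ⟨⟨hgauge, -⟩, hq⟩, rfl⟩ := hp
    obtain ⟨z, him, rfl⟩ := exists_coneMap_eq hn hq hgauge
    exact Set.mem_iUnion.2 ⟨k, _, ⟨z, him.trans hp1, rfl⟩, rfl⟩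
  · exact measure_iUnion_null fun k ↦ by
      rw [(isometry_rotY _).euclideanHausdorffMeasure_image, hnull]

lemma aedisjoint_image_rotY {n : ℕ} (hn : 2 ≤ n) {R : ℝ} (hR : 0 < R) {j k : Fin n}
    (hjk : j ≠ k) :
    AEDisjoint μHE[2] (rotY (2 * π * (j : ℕ) / n) '' (spindleHalfBoundary n R ∩ yWedge (π / n)))
      (rotY (2 * π * (k : ℕ) / n) '' (spindleHalfBoundary n R ∩ yWedge (π / n))) := by
  refine measure_mono_null ?_
    (((isometry_rotY (2 * π * (j : ℕ) / n)).euclideanHausdorffMeasure_image _).trans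
      (euclideanHausdorffMeasure_sep_mem_edge hn hR))
  rintro _ ⟨⟨p, ⟨hpT, hp⟩, rfl⟩, hpk⟩
  refine ⟨p, ⟨hpT, ?_⟩, rfl⟩
  rw [image_rotY, Set.mem_preimage, rotY_rotY] at hpk
  have hangle : -(2 * π * (k : ℕ) / n) + 2 * π * (j : ℕ) / n =
      ((j : ℕ) - (k : ℕ) : ℤ) * (2 * π / n) := by
    push_cast
    ring
  have hdvd : ¬ (n : ℤ) ∣ (j : ℕ) - (k : ℕ) := fun h ↦ by
    have := Int.eq_zero_of_abs_lt_dvd h (by rw [abs_lt]; omega)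
    exact hjk (Fin.ext (by omega))
  exact abs_mul_cos_eq_of_rotY_mem_yWedge hn hp hdvd (hangle ▸ hpk.2)

lemma euclideanHausdorffMeasure_spindleHalfBoundary {n : ℕ} (hn : 2 ≤ n) {R : ℝ} (hR : 0 < R) :
    μHE[2] (spindleHalfBoundary n R) = n * μHE[2] (spindleHalfBoundary n R ∩ yWedge (π / n)) := by
  have hmeas (k : Fin n) : MeasurableSet
      (rotY (2 * π * (k : ℕ) / n) '' (spindleHalfBoundary n R ∩ yWedge (π / n))) := by
    have hwedge : IsClosed (yWedge (π / n)) :=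
      isClosed_le (by fun_prop : Continuous fun p : E³ ↦ |p 0| * cos (π / n)) (by fun_prop)
    rw [image_rotY]
    exact (((isClosed_spindleHalfBoundary n R).inter hwedge).preimage
      (isometry_rotY _).continuous).measurableSet
  conv_lhs => rw [spindleHalfBoundary_eq_iUnion hn, measure_iUnion₀
    (fun _ _ ↦ aedisjoint_image_rotY hn hR) fun k ↦ (hmeas k).nullMeasurableSet]
  simp [(isometry_rotY _).euclideanHausdorffMeasure_image]

lemma surfaceArea_polycon_eq_two_mul {n : ℕ} (hn : 2 ≤ n) {R : ℝ} (hR : 0 < R) :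
    surfaceArea (polycon n R) = 2 * μHE[2] (spindleHalfBoundary n R) := by
  have hmeas : MeasurableSet (rotY (π / n) '' (reflY '' spindleHalfBoundary n R)) := by
    rw [image_rotY, image_reflY]
    exact (((isClosed_spindleHalfBoundary n R).preimage isometry_reflY.continuous).preimage
      (isometry_rotY _).continuous).measurableSet
  have hdisj : AEDisjoint μHE[2] (spindleHalfBoundary n R)
      (rotY (π / n) '' (reflY '' spindleHalfBoundary n R)) := by
    refine measure_mono_null ?_ (euclideanHausdorffMeasure_sep_apply_one_eq_zero hn R)
    rintro _ ⟨hp, -, ⟨q, hq, rfl⟩, rfl⟩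
    exact ⟨hp, le_antisymm (neg_nonpos.2 hq.2) hp.2⟩
  rw [surfaceArea, frontier_polycon hn hR, measure_union₀ hmeas.nullMeasurableSet hdisj,
    (isometry_rotY _).euclideanHausdorffMeasure_image,
    isometry_reflY.euclideanHausdorffMeasure_image, two_mul]

lemma surfaceArea_polycon {n : ℕ} (hn : 2 ≤ n) {R : ℝ} (hR : 0 < R) :
    surfaceArea (polycon n R) =
      ENNReal.ofReal (n * R ^ 2 / cos (π / (2 * n)) * polyconIntegral n) := by
  have hcos := cos_pi_div_two_mul_pos hn
  rw [surfaceArea_polycon_eq_two_mul hn hR, euclideanHausdorffMeasure_spindleHalfBoundary hn hR,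
    ← image_coneMap_conicSector hn, euclideanHausdorffMeasure_image_coneMap R hcos
      (isClosed_conicSector _ _).measurableSet,
    volume_conicSector hR.le (projEccentricity_nonneg hn), ← polyconIntegral,
    ← ENNReal.ofReal_ofNat, ← ENNReal.ofReal_natCast, ← ENNReal.ofReal_mul (by positivity),
    ← ENNReal.ofReal_mul (by positivity), ← ENNReal.ofReal_mul (by positivity)]
  congr 1
  field_simp

/-! ### Closed forms of the integrals -/

lemma cos_nonneg_of_mem_uIcc {θ : ℝ} (hθ : θ ∈ Set.uIcc (-(π / 2)) (π / 2)) : 0 ≤ cos θ := by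
  rw [Set.uIcc_of_le (by linarith [pi_pos])] at hθ
  exact cos_nonneg_of_mem_Icc hθ

lemma intervalIntegrable_one_div_add_mul_cos_pow {a b : ℝ} (ha : 0 < a) (hb : 0 ≤ b) (m : ℕ) :
    IntervalIntegrable (fun θ ↦ 1 / (a + b * cos θ) ^ m) volume (-(π / 2)) (π / 2) := by
  refine ContinuousOn.intervalIntegrable (continuousOn_const.div (by fun_prop) fun θ hθ ↦ ?_)
  have := cos_nonneg_of_mem_uIcc hθ
  positivity

lemma hasDerivAt_sin_div_one_add_mul_cos {e θ : ℝ} (h : 1 + e * cos θ ≠ 0) :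
    HasDerivAt (fun θ ↦ sin θ / (1 + e * cos θ)) ((cos θ + e) / (1 + e * cos θ) ^ 2) θ := by
  refine ((hasDerivAt_sin θ).div (((hasDerivAt_cos θ).const_mul e).const_add 1) h).congr_deriv ?_
  congr 1
  linear_combination e * sin_sq_add_cos_sq θ

lemma mul_integral_one_div_one_add_mul_cos_sq {e : ℝ} (he : 0 ≤ e) :
    (e ^ 2 - 1) * ∫ θ in (-(π / 2))..(π / 2), 1 / (1 + e * cos θ) ^ 2 =
      2 * e - ∫ θ in (-(π / 2))..(π / 2), 1 / (1 + e * cos θ) := by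
  have hint (m : ℕ) := intervalIntegrable_one_div_add_mul_cos_pow one_pos he m
  have hint1 := hint 1
  simp only [pow_one] at hint1
  have hderiv : ∀ θ ∈ Set.uIcc (-(π / 2)) (π / 2),
      HasDerivAt (fun θ ↦ e * (sin θ / (1 + e * cos θ)))
        ((e ^ 2 - 1) * (1 / (1 + e * cos θ) ^ 2) + 1 / (1 + e * cos θ)) θ := fun θ hθ ↦ by
    have hcos := cos_nonneg_of_mem_uIcc hθ
    have hpos : 0 < 1 + e * cos θ := by positivity
    refine ((hasDerivAt_sin_div_one_add_mul_cos hpos.ne').const_mul e).congr_deriv ?_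
    field_simp
    ring
  have hftc := intervalIntegral.integral_eq_sub_of_hasDerivAt hderiv
    (((hint 2).const_mul _).add hint1)
  rw [intervalIntegral.integral_add ((hint 2).const_mul _) hint1,
    intervalIntegral.integral_const_mul] at hftc
  simp only [sin_neg, cos_neg, sin_pi_div_two, cos_pi_div_two] at hftc
  linear_combination hftc

lemma hasDerivAt_log_sub_log {k θ : ℝ} (hp : 0 < 1 + cos θ + k * sin θ)
    (hm : 0 < 1 + cos θ - k * sin θ) (h : 0 < 1 - k ^ 2 + (1 + k ^ 2) * cos θ) :
    HasDerivAt (fun θ ↦ log (1 + cos θ + k * sin θ) - log (1 + cos θ - k * sin θ))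
      (2 * k / (1 - k ^ 2 + (1 + k ^ 2) * cos θ)) θ := by
  have hcos := (hasDerivAt_cos θ).const_add 1
  have hsin := (hasDerivAt_sin θ).const_mul k
  refine (((hcos.add hsin).log hp.ne').sub ((hcos.sub hsin).log hm.ne')).congr_deriv ?_
  simp only [Pi.add_apply, Pi.sub_apply]
  rw [div_sub_div _ _ hp.ne' hm.ne', div_eq_div_iff (by positivity) h.ne']
  linear_combination 2 * k * (1 + (1 + k ^ 2) * cos θ) * sin_sq_add_cos_sq θ

lemma integral_one_div_one_sub_sq_add_mul_cos {k : ℝ} (hk : 0 < k) (hk1 : k < 1) :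
    ∫ θ in (-(π / 2))..(π / 2), 1 / (1 - k ^ 2 + (1 + k ^ 2) * cos θ) =
      log ((1 + k) / (1 - k)) / k := by
  have hk2 : 0 < 1 - k ^ 2 := by nlinarith
  have hderiv : ∀ θ ∈ Set.uIcc (-(π / 2)) (π / 2), HasDerivAt
      (fun θ ↦ (log (1 + cos θ + k * sin θ) - log (1 + cos θ - k * sin θ)) / (2 * k))
      (1 / (1 - k ^ 2 + (1 + k ^ 2) * cos θ)) θ := fun θ hθ ↦ by
    have hcos := cos_nonneg_of_mem_uIcc hθ
    have hpos : 0 < 1 - k ^ 2 + (1 + k ^ 2) * cos θ := by positivity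
    have hp : 0 < 1 + cos θ + k * sin θ := by nlinarith [neg_one_le_sin θ]
    have hm : 0 < 1 + cos θ - k * sin θ := by nlinarith [sin_le_one θ]
    refine ((hasDerivAt_log_sub_log hp hm hpos).div_const (2 * k)).congr_deriv ?_
    field_simp
  have hint := intervalIntegrable_one_div_add_mul_cos_pow hk2 (by positivity : 0 ≤ 1 + k ^ 2) 1
  simp only [pow_one] at hint
  rw [intervalIntegral.integral_eq_sub_of_hasDerivAt hderiv hint,
    log_div (by positivity) (by linarith)]
  simp only [sin_neg, cos_neg, sin_pi_div_two, cos_pi_div_two, add_zero, mul_one, mul_neg,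
    sub_neg_eq_add, ← sub_eq_add_neg]
  field_simp
  ring

lemma integral_one_div_one_add_mul_cos_sq {e k : ℝ} (hk : 0 < k) (hk1 : k < 1)
    (he : e * (1 - k ^ 2) = 1 + k ^ 2) :
    ∫ θ in (-(π / 2))..(π / 2), 1 / (1 + e * cos θ) ^ 2 =
      (1 - k ^ 2) / (4 * k ^ 2) *
        (2 * (1 + k ^ 2) - (1 - k ^ 2) ^ 2 / k * log ((1 + k) / (1 - k))) := by
  have hk2 : 0 < 1 - k ^ 2 := by nlinarith
  obtain rfl : e = (1 + k ^ 2) / (1 - k ^ 2) := eq_div_of_mul_eq hk2.ne' he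
  have hscale (θ : ℝ) : 1 / (1 + (1 + k ^ 2) / (1 - k ^ 2) * cos θ) =
      (1 - k ^ 2) * (1 / (1 - k ^ 2 + (1 + k ^ 2) * cos θ)) := by
    rw [show 1 + (1 + k ^ 2) / (1 - k ^ 2) * cos θ =
      (1 - k ^ 2 + (1 + k ^ 2) * cos θ) / (1 - k ^ 2) by field_simp, one_div_div, mul_one_div]
  have hred := mul_integral_one_div_one_add_mul_cos_sq
    (by positivity : 0 ≤ (1 + k ^ 2) / (1 - k ^ 2))
  simp only [hscale] at hred
  rw [intervalIntegral.integral_const_mul, integral_one_div_one_sub_sq_add_mul_cos hk hk1] at hred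
  have hsq : ((1 + k ^ 2) / (1 - k ^ 2)) ^ 2 - 1 = 4 * k ^ 2 / (1 - k ^ 2) ^ 2 := by
    field_simp
    ring
  rw [hsq, mul_comm] at hred
  rw [eq_div_of_mul_eq (by positivity) hred]
  field_simp

lemma integral_one_div_one_add_cos_sq :
    ∫ θ in (-(π / 2))..(π / 2), 1 / (1 + cos θ) ^ 2 = 4 / 3 := by
  have hderiv : ∀ θ ∈ Set.uIcc (-(π / 2)) (π / 2),
      HasDerivAt (fun θ ↦ sin θ * (2 + cos θ) / (3 * (1 + cos θ) ^ 2))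
        (1 / (1 + cos θ) ^ 2) θ := fun θ hθ ↦ by
    have hcos := cos_nonneg_of_mem_uIcc hθ
    have hpos : 0 < 1 + cos θ := by positivity
    refine (((hasDerivAt_sin θ).mul ((hasDerivAt_cos θ).const_add 2)).div
      ((((hasDerivAt_cos θ).const_add 1).pow 2).const_mul 3)
      (mul_ne_zero three_ne_zero (pow_ne_zero 2 hpos.ne'))).congr_deriv ?_
    simp only [Pi.mul_apply, Pi.pow_apply]
    field_simp
    push_cast
    linear_combination (1 + cos θ) * (3 + cos θ) * sin_sq_add_cos_sq θ
  have hint := intervalIntegrable_one_div_add_mul_cos_pow one_pos zero_le_one 2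
  simp only [one_mul] at hint
  rw [intervalIntegral.integral_eq_sub_of_hasDerivAt hderiv hint]
  simp only [sin_neg, cos_neg, sin_pi_div_two, cos_pi_div_two]
  norm_num

lemma projEccentricity_eq {n : ℕ} (hn : 2 ≤ n) :
    projEccentricity n = cos (π / n) / (1 - cos (π / n)) := by
  have hs := (sin_pi_div_two_mul_pos hn).ne'
  have hc := (cos_pi_div_two_mul_pos hn).ne'
  have hdouble : π / n = 2 * (π / (2 * n)) := by ring
  have hcos : 1 - cos (π / n) = 2 * sin (π / (2 * n)) ^ 2 := by
    rw [hdouble, cos_two_mul']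
    linear_combination -sin_sq_add_cos_sq (π / (2 * n))
  have hsin : sin (π / n) = 2 * sin (π / (2 * n)) * cos (π / (2 * n)) := by
    rw [hdouble, sin_two_mul]
  rw [projEccentricity, cot_eq_cos_div_sin, cot_eq_cos_div_sin, hcos, hsin]
  generalize π / (2 * (n : ℝ)) = α at *
  field_simp

lemma four_mul_cosProd (n : ℕ) : 4 * cosProd n = 2 * cos (π / n) - 1 := by
  have hdouble : π / n = 2 * (π / (2 * n)) := by ring
  have hsqrt : √(3 : ℝ) ^ 2 = 3 := sq_sqrt (by norm_num)
  rw [cosProd, cos_sub, cos_add, cos_pi_div_three, sin_pi_div_three, hdouble, cos_two_mul']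
  linear_combination (-sin (π / (2 * n)) ^ 2) * hsqrt - sin_sq_add_cos_sq (π / (2 * n))

lemma projEccentricity_two : projEccentricity 2 = 0 := by
  rw [projEccentricity_eq le_rfl, Nat.cast_ofNat, cos_pi_div_two, zero_div]

lemma projEccentricity_three : projEccentricity 3 = 1 := by
  rw [projEccentricity_eq (by norm_num), Nat.cast_ofNat, cos_pi_div_three]
  norm_num

lemma polyconIntegral_two : polyconIntegral 2 = π := by
  simp [polyconIntegral, projEccentricity_two]

lemma polyconIntegral_three : polyconIntegral 3 = 4 / 3 := by
  simpa only [polyconIntegral, projEccentricity_three, one_mul] using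
    integral_one_div_one_add_cos_sq

lemma half_lt_cos_pi_div {n : ℕ} (hn : 3 < n) : 1 / 2 < cos (π / n) := by
  rw [← cos_pi_div_three]
  have hn' : (3 : ℝ) < n := by exact_mod_cast hn
  refine cos_lt_cos_of_nonneg_of_le_pi (by positivity) (by linarith [pi_pos]) ?_
  have := pi_pos
  gcongr

lemma cos_pi_div_lt_one {n : ℕ} (hn : 2 ≤ n) : cos (π / n) < 1 := by
  rw [← cos_zero]
  have hpi := pi_div_mem_Ioc hn
  exact cos_lt_cos_of_nonneg_of_le_pi le_rfl (by linarith [hpi.2, pi_pos]) hpi.1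

lemma polyconIntegral_of_three_lt {n : ℕ} (hn : 3 < n) :
    polyconIntegral n =
      (1 - cos (π / n)) / cosProd n *
        (cos (π / n) / 2 -
          (1 - cos (π / n)) ^ 2 / (4 * √(cosProd n)) *
            log ((1 + 2 * √(cosProd n)) / (1 - 2 * √(cosProd n)))) := by
  have hhalf := half_lt_cos_pi_div hn
  have hone : 0 < 1 - cos (π / n) := sub_pos.2 (cos_pi_div_lt_one (by omega))
  have hq : 0 < cosProd n := by linarith [four_mul_cosProd n]
  have hsqrt : 0 < √(cosProd n) := sqrt_pos.2 hq
  have hsq : √(cosProd n) ^ 2 = cosProd n := sq_sqrt hq.le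
  have hcos : 2 * cos (π / n) = 1 + (2 * √(cosProd n)) ^ 2 := by
    linear_combination -four_mul_cosProd n - 4 * hsq
  have hecc : projEccentricity n * (1 - (2 * √(cosProd n)) ^ 2) = 1 + (2 * √(cosProd n)) ^ 2 := by
    rw [projEccentricity_eq (by omega), ← hcos, div_mul_eq_mul_div, div_eq_iff hone.ne']
    linear_combination cos (π / n) * hcos
  rw [polyconIntegral, integral_one_div_one_add_mul_cos_sq (by positivity) (by nlinarith) hecc]
  have h2 : 1 - (2 * √(cosProd n)) ^ 2 = 2 * (1 - cos (π / n)) := by linarith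
  rw [← hcos, h2, mul_pow, hsq]
  field_simp
  ring

lemma surfaceArea_polycon_two {R : ℝ} (hR : 0 < R) :
    surfaceArea (polycon 2 R) = ENNReal.ofReal (2 * √2 * π * R ^ 2) := by
  rw [surfaceArea_polycon le_rfl hR, polyconIntegral_two]
  congr 1
  have hangle : π / (2 * (2 : ℕ)) = π / 4 := by norm_num
  have hsqrt : √(2 : ℝ) ^ 2 = 2 := sq_sqrt (by norm_num)
  rw [hangle, cos_pi_div_four]
  push_cast
  field_simp
  linear_combination -hsqrt

lemma surfaceArea_polycon_three {R : ℝ} (hR : 0 < R) :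
    surfaceArea (polycon 3 R) = ENNReal.ofReal (8 * R ^ 2 / √3) := by
  rw [surfaceArea_polycon (by norm_num) hR, polyconIntegral_three]
  congr 1
  have hangle : π / (2 * (3 : ℕ)) = π / 6 := by norm_num
  rw [hangle, cos_pi_div_six]
  push_cast
  field_simp
  norm_num

theorem mainTheorem4 (R : ℝ) (hR : 0 < R) :
    (∀ n : ℕ, 2 ≤ n →
      surfaceArea (polycon n R) =
        ENNReal.ofReal (n * R ^ 2 / cos (π / (2 * n)) * polyconIntegral n)) ∧
    polyconIntegral 2 = π ∧
    polyconIntegral 3 = 4 / 3 ∧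
    (∀ n : ℕ, 3 < n →
      polyconIntegral n =
        (1 - cos (π / n)) / cosProd n *
          (cos (π / n) / 2 -
            (1 - cos (π / n)) ^ 2 / (4 * √(cosProd n)) *
              log ((1 + 2 * √(cosProd n)) / (1 - 2 * √(cosProd n))))) ∧
    surfaceArea (polycon 2 R) = ENNReal.ofReal (2 * √2 * π * R ^ 2) ∧
    surfaceArea (polycon 3 R) = ENNReal.ofReal (8 * R ^ 2 / √3) :=
  ⟨fun _ hn ↦ surfaceArea_polycon hn hR, polyconIntegral_two, polyconIntegral_three,
    fun _ hn ↦ polyconIntegral_of_three_lt hn, surfaceArea_polycon_two hR,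
    surfaceArea_polycon_three hR⟩
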